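/- Let $p$ be a prime number, $k$ a finite extension of $\mathbb{Q}_p$, $\Omega$ a smooth projective geometrically integral curve over $k$, and $K = k(\Omega)$ its function field. Let $m \ge 2$ be an integer such that the extension $K(\mu_{2^m})/K$ is cyclic, where $\mu_{2^m}$ denotes the group of $2^m$-th roots of unity in an algebraic closure of $K$. Then every finite abelian group $F$ whose exponent is not divisible by $2^{m+1}$ is a Galois group over $K$; that is, there exists a finite Galois extension $L/K$ with $\operatorname{Gal}(L/K) \cong F$. -/

import Mathlib

universe u

open CategoryTheory AlgebraicGeometry

noncomputable section

attribute [local instance] MvPolynomial.gradedAlgebra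

/-- Projective `n`-space over a field `k`, as `Proj k[x₀, …, xₙ]`. -/
def projSpace (k : Type u) [Field k] (n : ℕ) : Scheme.{u} :=
  Proj (MvPolynomial.homogeneousSubmodule (Fin (n + 1)) k)

/-- The structure morphism `ℙⁿ_k ⟶ Spec k`, i.e. the canonical morphism from `Proj` to the
spectrum of the degree zero part, followed by the map induced by the `k`-algebra structure of
that degree zero part. -/
def projSpaceToSpec (k : Type u) [Field k] (n : ℕ) :
    projSpace k n ⟶ Spec (CommRingCat.of k) :=
  Proj.toSpecZero (MvPolynomial.homogeneousSubmodule (Fin (n + 1)) k) ≫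
    Spec.map (CommRingCat.ofHom
      (algebraMap k (MvPolynomial.homogeneousSubmodule (Fin (n + 1)) k 0)))

/-- `f : Ω ⟶ Spec k` makes `Ω` a projective `k`-scheme: over `k`, it is isomorphic to a closed
subscheme of some `ℙⁿ_k`. -/
def IsProjectiveOver {k : Type u} [Field k] {Ω : Scheme.{u}}
    (f : Ω ⟶ Spec (CommRingCat.of k)) : Prop :=
  ∃ (n : ℕ) (i : Ω ⟶ projSpace k n), IsClosedImmersion i ∧ i ≫ projSpaceToSpec k n = f

/-- `f : Ω ⟶ Spec k` makes `Ω` a smooth projective geometrically integral curve over `k`. -/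
structure IsSmoothProjectiveCurve {k : Type u} [Field k] {Ω : Scheme.{u}}
    (f : Ω ⟶ Spec (CommRingCat.of k)) : Prop where
  smooth : SmoothOfRelativeDimension 1 f
  projective : IsProjectiveOver f
  geometricallyIntegral : GeometricallyIntegral f

/-- A geometrically integral scheme over a field is integral, so it has a function field. -/
theorem IsSmoothProjectiveCurve.isIntegral {k : Type u} [Field k] {Ω : Scheme.{u}}
    {f : Ω ⟶ Spec (CommRingCat.of k)} (hf : IsSmoothProjectiveCurve f) : IsIntegral Ω := by
  have := hf.geometricallyIntegral
  have : Subsingleton (Spec (CommRingCat.of k)) :=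
    inferInstanceAs (Subsingleton (PrimeSpectrum k))
  exact GeometricallyIntegral.isIntegral_of_subsingleton f

/-- `K` is a `p`-adic function field: it is (isomorphic to) the function field `k(Ω)` of a smooth
projective geometrically integral curve `Ω` over a finite extension `k` of `ℚ_p`. -/
def IsPAdicFunctionField (p : ℕ) [Fact p.Prime] (K : Type u) [Field K] : Prop :=
  ∃ (k : Type u) (_ : Field k) (_ : Algebra ℚ_[p] k) (_ : FiniteDimensional ℚ_[p] k)
    (Ω : Scheme.{u}) (f : Ω ⟶ Spec (CommRingCat.of k)) (hf : IsSmoothProjectiveCurve f),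
    haveI : IsIntegral Ω := hf.isIntegral
    Nonempty (K ≃+* Ω.functionField)

/-- The finite group `G` is a Galois group over `K`: there is a finite Galois extension `L/K`
with `Gal(L/K) ≃ G`. -/
def IsGaloisGroupOver (K : Type u) [Field K] (G : Type*) [Group G] : Prop :=
  ∃ (L : Type u) (_ : Field L) (_ : Algebra K L),
    FiniteDimensional K L ∧ IsGalois K L ∧ Nonempty (Gal(L/K) ≃* G)

end

/-! The only facts used about `K` are that it is finitely generated over a field of characteristic
zero and contains an element `t` transcendental over that field. Write `F` as a product of cyclic
groups of orders `q i ^ r i`. The Galois group acts on a root of unity `ζ i` of that order through a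
cyclic group: for odd `q i` because the unit group modulo `q i ^ r i` is cyclic, for `q i = 2`
because `r i ≤ m`.

For such a `ζ` of order `n = q ^ r > 1`, a Stickelberger-type product of powers of the elements `t -
c - ζ ^ u` has an `n`-th root `β` in an abelian extension of `K` (`exists_kummer_descent`). A
suitable integer `c` keeps `β ^ n` from being a `q`-th power in a prescribed finite extension
(`exists_aeval_sub_natCast_ne_pow`). Adjoining such radicals one by one to the field `E` generated
by all `ζ i` gives a finite abelian `L/K` with `Gal(L/E)` surjecting onto `F`. So `F` is a quotient
of a subgroup of the finite abelian group `Gal(L/K)`, and by duality a quotient of `Gal(L/K)`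
itself. -/

/-! ### From the curve to a finitely generated field with a transcendental element -/

/-- If `K/k` were algebraic it would be formally étale, so `Ω[A⁄k]` would vanish after base change
to `K`; but it is free of rank one. -/
theorem exists_transcendental_of_isStandardSmoothOfRelativeDimension_one
    {k A K : Type*} [Field k] [CharZero k] [CommRing A] [IsDomain A] [Field K] [Algebra k A]
    [Algebra A K] [Algebra k K] [IsScalarTower k A K] [IsFractionRing A K]
    [Algebra.IsStandardSmoothOfRelativeDimension 1 k A] : ∃ t : K, Transcendental k t := by
  by_contra! h
  have : Algebra.IsAlgebraic k K := ⟨fun x => by simpa [Transcendental] using h x⟩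
  have hr := Algebra.IsStandardSmoothOfRelativeDimension.rank_kaehlerDifferential (R := k) (S := A) 1
  have : Algebra.FormallyEtale k K := Algebra.FormallyEtale.of_isSeparable k K
  have : Algebra.FormallyEtale A K := .of_isLocalization (nonZeroDivisors A)
  have e := KaehlerDifferential.tensorKaehlerEquivOfFormallyEtale k A K
  have : Subsingleton (TensorProduct A K Ω[A⁄k]) := e.toEquiv.subsingleton
  have := Algebra.IsStandardSmoothOfRelativeDimension.isStandardSmooth 1 (R := k) (S := A)
  have h1 := Module.rank_baseChange (R := K) (S := A) (M' := Ω[A⁄k])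
  rw [hr, rank_subsingleton'] at h1
  simp at h1

theorem IsPAdicFunctionField.exists_transcendental {p : ℕ} [Fact p.Prime] {K : Type u} [Field K]
    (hK : IsPAdicFunctionField p K) :
    ∃ (k : Type u) (_ : Field k) (_ : CharZero k) (_ : Algebra k K),
      Algebra.EssFiniteType k K ∧ ∃ t : K, Transcendental k t := by
  obtain ⟨k, _, _, _, Ω, f, hf, ⟨e⟩⟩ := hK
  have : IsIntegral Ω := hf.isIntegral
  have := hf.smooth
  obtain ⟨x⟩ : Nonempty Ω := inferInstance
  obtain ⟨U, hU, V, hV, hx, h, hs⟩ :=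
    SmoothOfRelativeDimension.exists_isStandardSmoothOfRelativeDimension (n := 1) (f := f) x
  have : Subsingleton (Spec (CommRingCat.of k)) :=
    inferInstanceAs (Subsingleton (PrimeSpectrum k))
  obtain rfl : U = ⊤ := by
    ext y
    simpa using (Subsingleton.elim (f x) y) ▸ h hx
  have e' : Γ(Spec (CommRingCat.of k), ⊤) ≃+* k :=
    (Scheme.ΓSpecIso (CommRingCat.of k)).commRingCatIsoToRingEquiv
  have hfield : IsField Γ(Spec (CommRingCat.of k), ⊤) := e'.toMulEquiv.isField (Field.toIsField k)
  let := hfield.toField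
  have : CharZero Γ(Spec (CommRingCat.of k), ⊤) := by
    have : CharZero k := charZero_of_injective_algebraMap (algebraMap ℚ_[p] k).injective
    exact charZero_of_injective_ringHom (e'.symm : k →+* _).injective
  have : Nonempty V := ⟨⟨x, hx⟩⟩
  have := functionField_isFractionRing_of_isAffineOpen Ω V hV
  algebraize [(f.appLE ⊤ V h).hom]
  let : Algebra Γ(Ω, V) K := (e.symm.toRingHom.comp (algebraMap Γ(Ω, V) Ω.functionField)).toAlgebra
  let : Algebra Γ(Spec (CommRingCat.of k), ⊤) K :=
    ((algebraMap Γ(Ω, V) K).comp (algebraMap Γ(Spec (CommRingCat.of k), ⊤) Γ(Ω, V))).toAlgebra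
  have : IsScalarTower Γ(Spec (CommRingCat.of k), ⊤) Γ(Ω, V) K := .of_algebraMap_eq' rfl
  have : IsFractionRing Γ(Ω, V) K :=
    IsLocalization.isLocalization_of_algEquiv (nonZeroDivisors Γ(Ω, V)) (S := Ω.functionField)
      (AlgEquiv.ofRingEquiv (f := e.symm) fun _ => rfl)
  have : Algebra.EssFiniteType Γ(Ω, V) K := .of_isLocalization _ (nonZeroDivisors Γ(Ω, V))
  have : Algebra.IsStandardSmooth Γ(Spec (CommRingCat.of k), ⊤) Γ(Ω, V) :=
    Algebra.IsStandardSmoothOfRelativeDimension.isStandardSmooth 1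
  -- The base field is taken to be the global sections of `Spec k`, which avoids transporting
  -- smoothness along the isomorphism with `k`.
  refine ⟨Γ(Spec (CommRingCat.of k), ⊤), inferInstance, inferInstance, inferInstance,
    .comp _ Γ(Ω, V) _, ?_⟩
  exact exists_transcendental_of_isStandardSmoothOfRelativeDimension_one (A := Γ(Ω, V))

/-! ### Quotients of finite abelian groups and of Galois groups -/

theorem CommGroup.nonempty_dual_mulEquiv (G : Type*) [CommGroup G] [Finite G] :
    Nonempty ((G →* (AlgebraicClosure ℚ)ˣ) ≃* G) :=
  have : NeZero (Monoid.exponent G) := ⟨Monoid.exponent_ne_zero_of_finite⟩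
  CommGroup.monoidHom_mulEquiv_of_hasEnoughRootsOfUnity G _

/-- A quotient of a subgroup of a finite abelian group is a quotient of the group. -/
theorem CommGroup.exists_surjective_of_subgroup_surjective {A F : Type*} [CommGroup A] [Finite A]
    [CommGroup F] [Finite F] (B : Subgroup A) (φ : B →* F) (hφ : Function.Surjective φ) :
    ∃ ψ : A →* F, Function.Surjective ψ := by
  obtain ⟨eA⟩ := CommGroup.nonempty_dual_mulEquiv A
  obtain ⟨eB⟩ := CommGroup.nonempty_dual_mulEquiv B
  obtain ⟨eF⟩ := CommGroup.nonempty_dual_mulEquiv F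
  -- `F` embeds into `B`, hence into `A`
  let i : F →* A := B.subtype.comp (eB.toMonoidHom.comp
    ((MonoidHom.compHom' φ).comp eF.symm.toMonoidHom))
  have hi : Function.Injective i := fun a b hab =>
    eF.symm.injective ((MonoidHom.cancel_right hφ).1 (eB.injective (B.subtype_injective hab)))
  let j := MonoidHom.ofInjective hi
  have : NeZero (Monoid.exponent A) := ⟨Monoid.exponent_ne_zero_of_finite⟩
  -- Characters of the copy of `F` inside `A` extend to `A`, so the dual of `A` surjects onto the
  -- dual of `F`; both groups are self-dual.
  have hres := MonoidHom.domRestrict_surjective (M := AlgebraicClosure ℚ) i.range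
  refine ⟨eF.toMonoidHom.comp ((MonoidHom.compHom' j.toMonoidHom).comp
    ((MonoidHom.domRestrictHom i.range _).comp eA.symm.toMonoidHom)), ?_⟩
  intro y
  obtain ⟨c, hc⟩ := hres ((eF.symm y).comp j.symm.toMonoidHom)
  refine ⟨eA c, eF.symm.injective (MonoidHom.ext fun x => ?_)⟩
  simpa [j] using DFunLike.congr_fun hc (j x)

/-- Since `G ⧸ H` is finite abelian and `φ` factors through the image of `N` in it, duality extends
the quotient from that subgroup to all of `G ⧸ H`, though `ψ` need not extend `φ`. -/
theorem exists_surjective_of_commutator_le {G F : Type*} [Group G] [CommGroup F] [Finite F]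
    {H N : Subgroup G} (hH : commutator G ≤ H) [H.FiniteIndex] (φ : N →* F)
    (hφ : Function.Surjective φ) (h : ∀ g : N, (g : G) ∈ H → φ g = 1) :
    ∃ ψ : G →* F, Function.Surjective ψ ∧ ∀ g ∈ H, ψ g = 1 := by
  have : H.Normal := Subgroup.Normal.of_commutator_le _ hH
  let _ : CommGroup (G ⧸ H) :=
    { (inferInstance : Group (G ⧸ H)) with
      mul_comm := fun a b => by
        have := (Subgroup.Normal.quotient_commutative_iff_commutator_le (N := H)).2 hH
        exact mul_comm' a b }
  have : Finite (G ⧸ H) := inferInstance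
  let π : N →* N.map (QuotientGroup.mk' H) := (QuotientGroup.mk' H).subgroupMap N
  have hπ : Function.Surjective π := (QuotientGroup.mk' H).subgroupMap_surjective N
  have hker : π.ker ≤ φ.ker := fun g hg => h g <| by
    have := congrArg Subtype.val (MonoidHom.mem_ker.1 hg)
    exact (QuotientGroup.eq_one_iff _).1 this
  let φ' := π.liftOfSurjective hπ ⟨φ, hker⟩
  have hφ' : Function.Surjective φ' := fun y => by
    obtain ⟨x, rfl⟩ := hφ y
    exact ⟨π x, π.liftOfRightInverse_comp_apply _ _ ⟨φ, hker⟩ x⟩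
  obtain ⟨ψ, hψ⟩ := CommGroup.exists_surjective_of_subgroup_surjective _ φ' hφ'
  refine ⟨ψ.comp (QuotientGroup.mk' H), hψ.comp (QuotientGroup.mk'_surjective H), fun g hg => ?_⟩
  rw [MonoidHom.comp_apply, QuotientGroup.mk'_apply, (QuotientGroup.eq_one_iff g).2 hg, map_one]

theorem isGaloisGroupOver_of_surjective {K : Type u} [Field K] [PerfectField K] {F : Type*} [Group F]
    (L : IntermediateField K (AlgebraicClosure K)) [FiniteDimensional K L]
    (ψ : Gal(AlgebraicClosure K/K) →* F) (hψ : Function.Surjective ψ)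
    (h : ∀ g ∈ L.fixingSubgroup, ψ g = 1) : IsGaloisGroupOver K F := by
  have ho : IsOpen (ψ.ker : Set Gal(AlgebraicClosure K/K)) :=
    Subgroup.isOpen_mono (H₁ := L.fixingSubgroup) h L.fixingSubgroup_isOpen
  let H : ClosedSubgroup Gal(AlgebraicClosure K/K) := ⟨ψ.ker, Subgroup.isClosed_of_isOpen _ ho⟩
  have hn : H.toSubgroup.Normal := inferInstanceAs ψ.ker.Normal
  let E := IntermediateField.fixedField H.toSubgroup
  have hE : E.fixingSubgroup = ψ.ker := InfiniteGalois.fixingSubgroup_fixedField H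
  have := (InfiniteGalois.isOpen_and_normal_iff_finite_and_isGalois E).1
    ⟨by rw [hE]; exact ho, by rw [hE]; exact hn⟩
  exact ⟨E, inferInstance, inferInstance, this.1, this.2,
    ⟨(InfiniteGalois.normalAutEquivQuotient H).symm.trans
      (QuotientGroup.quotientKerEquivOfSurjective ψ hψ)⟩⟩

/-! ### Kummer characters and independence of radicals -/

/-- The Kummer character of an `n`-th root `β` of an invariant element, for a group fixing the
`n`-th roots of unity. -/
theorem exists_kummerCharacter {G L : Type*} [Group G] [Field L] [MulSemiringAction G L] {n : ℕ}
    [NeZero n] {ζ : L} (hζ : IsPrimitiveRoot ζ n) (hG : ∀ g : G, g • ζ = ζ) {β : L} (hβ : β ≠ 0)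
    (hβG : ∀ g : G, g • β ^ n = β ^ n) :
    ∃ κ : G →* rootsOfUnity n L, ∀ g, g • β = ((κ g : Lˣ) : L) * β := by
  have hpow : ∀ g : G, (g • β / β) ^ n = 1 := fun g => by
    rw [div_pow, ← smul_pow', hβG, div_self (pow_ne_zero _ hβ)]
  have hfix : ∀ g h : G, g • (h • β / β) = h • β / β := fun g h => by
    obtain ⟨i, -, hi⟩ := hζ.eq_pow_of_pow_eq_one (hpow h)
    rw [← hi, smul_pow', hG]
  refine ⟨MonoidHom.mk' (fun g => rootsOfUnity.mkOfPowEq _ (hpow g)) fun g h => ?_, fun g => ?_⟩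
  · ext
    simp only [rootsOfUnity.val_mkOfPowEq_coe, Subgroup.coe_mul, Units.val_mul]
    rw [← hfix g h, smul_div₀', ← mul_smul]
    have : g • β ≠ 0 := (smul_ne_zero_iff_ne g).2 hβ
    field_simp
  · simp [hβ]

/-- Each `y i` is an eigenvector of the absolute Galois group of `E`, with its Kummer character as
eigenvalue. These characters are distinct because no ratio lies in `E`, so Dedekind's independence
of characters applies. -/
theorem linearIndependent_of_pow_mem {ι E M : Type*} [Field E] [CharZero E] [Field M] [Algebra E M]
    [Algebra.IsAlgebraic E M] {n : ℕ} [NeZero n] {ζ : E} (hζ : IsPrimitiveRoot ζ n) (y : ι → M)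
    (h0 : ∀ i, y i ≠ 0) (hn : ∀ i, y i ^ n ∈ Set.range (algebraMap E M))
    (hy : ∀ i j, y i / y j ∈ Set.range (algebraMap E M) → i = j) : LinearIndependent E y := by
  let Ω := AlgebraicClosure M
  have : IsAlgClosure E Ω := ⟨inferInstance, Algebra.IsAlgebraic.trans E M Ω⟩
  have : IsGalois E Ω := inferInstance
  let z : ι → Ω := fun i => algebraMap M Ω (y i)
  have hz0 : ∀ i, z i ≠ 0 := fun i => by simpa [z] using h0 i
  have hκ : ∀ i, ∃ κ : Gal(Ω/E) →* rootsOfUnity n Ω, ∀ g, g • z i = ((κ g : Ωˣ) : Ω) * z i := by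
    intro i
    refine exists_kummerCharacter (hζ.map_of_injective (algebraMap E Ω).injective)
      (fun g => g.commutes ζ) (hz0 i) fun g => ?_
    obtain ⟨a, ha⟩ := hn i
    have : z i ^ n = algebraMap E Ω a := by
      rw [IsScalarTower.algebraMap_apply E M Ω, ha, map_pow]
    rw [this]
    exact g.commutes a
  choose κ hκ using hκ
  let χ : ι → (Gal(Ω/E) →* Ω) := fun i =>
    (Units.coeHom Ω).comp ((rootsOfUnity n Ω).subtype.comp (κ i))
  have hχ : ∀ i g, g (z i) = χ i g * z i := hκ
  have hinj : Function.Injective χ := by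
    intro i j hij
    refine hy i j ?_
    obtain ⟨a, ha⟩ := (InfiniteGalois.mem_range_algebraMap_iff_fixed (k := E) (z i / z j)).2 (by
      intro g
      have : χ j g ≠ 0 := fun h => by simpa [h, hz0 j] using hχ j g
      rw [map_div₀, hχ, hχ, hij, mul_div_mul_left _ _ this])
    refine ⟨a, (algebraMap M Ω).injective ?_⟩
    rw [← IsScalarTower.algebraMap_apply, ha, map_div₀]
  have hli := (linearIndependent_monoidHom Gal(Ω/E) Ω).comp χ hinj
  rw [linearIndependent_iff'] at hli ⊢
  intro s a ha i hi
  have := hli s (fun i => algebraMap E Ω (a i) * z i) (by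
    ext g
    have h1 : ∑ i ∈ s, algebraMap E Ω (a i) * z i = 0 := by
      simpa [Algebra.smul_def, z, ← IsScalarTower.algebraMap_apply] using
        congrArg (algebraMap M Ω) ha
    have h2 := congrArg g h1
    simp only [map_sum, map_mul, hχ, AlgEquiv.commutes, map_zero] at h2
    simp only [Finset.sum_apply, Pi.smul_apply, Function.comp_apply, smul_eq_mul, Pi.zero_apply]
    rw [← h2]
    exact Finset.sum_congr rfl fun i _ => by ring) i hi
  simpa [hz0] using this

/-! ### Translates of a polynomial that are not powers -/

section

open Polynomial IntermediateField.algebraAdjoinAdjoin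

theorem Polynomial.rootMultiplicity_pow_eq {R : Type*} [CommRing R] [IsDomain R] {p : R[X]}
    (hp : p ≠ 0) (a : R) (n : ℕ) : rootMultiplicity a (p ^ n) = n * rootMultiplicity a p := by
  induction n with
  | zero => simp
  | succ n ih => rw [pow_succ, rootMultiplicity_mul (by simp [hp]), ih]; ring

/-- If every translate had a `q`-th root in `M`, the roots for widely spaced translates would be
linearly independent over `E`: a ratio lying in `E` would make the simple zero of one translate have
order divisible by `q`. This contradicts finiteness of `M/E`. -/
theorem exists_comp_X_sub_C_ne_pow {k E M : Type*} [Field k] [CharZero k] [Field E] [Algebra k[X] E]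
    [IsFractionRing k[X] E] [Field M] [Algebra E M] [FiniteDimensional E M] {q : ℕ} (hq : 2 ≤ q)
    {ζ : k} (hζ : IsPrimitiveRoot ζ q) {f : k[X]} {θ : k} (hθ : f.rootMultiplicity θ = 1) :
    ∃ c : ℕ, ∀ y : M, y ^ q ≠ algebraMap E M (algebraMap k[X] E (f.comp (X - C (c : k)))) := by
  have hf : f ≠ 0 := fun h => by simp [h] at hθ
  have : NeZero q := ⟨by omega⟩
  have hE : Function.Injective (algebraMap k[X] E) := IsFractionRing.injective k[X] E
  have : CharZero E := charZero_of_injective_ringHom ((algebraMap k[X] E).comp C).injective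
  have hζE : IsPrimitiveRoot (algebraMap k[X] E (C ζ)) q :=
    (hζ.map_of_injective C_injective).map_of_injective hE
  by_contra! h
  choose y hy using h
  have hfin : {d : ℤ | f.IsRoot (θ + d)}.Finite :=
    (finite_setOfPred_isRoot hf).preimage fun a _ b _ hab => by simpa using hab
  -- With spacing `D`, the zero `θ + D * i` of the `i`-th translate is not a zero of any other.
  obtain ⟨D, hD0, hD⟩ : ∃ D : ℕ, 0 < D ∧ ∀ d : ℤ, (D : ℤ) ≤ |d| → ¬ f.IsRoot (θ + d) := by
    obtain ⟨D, hD⟩ := (hfin.image Int.natAbs).bddAbove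
    refine ⟨D + 1, by omega, fun d hd hroot => ?_⟩
    have : d.natAbs ≤ D := hD ⟨d, hroot, rfl⟩
    rw [Int.abs_eq_natAbs] at hd
    omega
  let g : ℕ → k[X] := fun i => f.comp (X - C ((D * i : ℕ) : k))
  have hmult : ∀ i a, (g i).rootMultiplicity a = f.rootMultiplicity (a - (D * i : ℕ)) := by
    intro i a
    rw [rootMultiplicity_eq_rootMultiplicity, rootMultiplicity_eq_rootMultiplicity (p := f)]
    simp only [g, comp_assoc]
    congr 2
    simp
    ring
  have hg0 : ∀ i, g i ≠ 0 := fun i h => by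
    have := hmult i (θ + (D * i : ℕ))
    rw [h, add_sub_cancel_right, hθ] at this
    simp at this
  have hy0 : ∀ i, y (D * i) ≠ 0 := fun i h => by
    have := hy (D * i)
    rw [h, zero_pow (by omega), eq_comm, map_eq_zero, map_eq_zero_iff _ hE] at this
    exact hg0 i this
  have hli : LinearIndependent E fun i : ℕ => y (D * i) := by
    refine linearIndependent_of_pow_mem hζE _ hy0 (fun i => ⟨_, (hy _).symm⟩) ?_
    rintro i j ⟨u, hu⟩
    by_contra hij
    have hpow : u ^ q * algebraMap k[X] E (g j) = algebraMap k[X] E (g i) := by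
      apply (algebraMap E M).injective
      rw [map_mul, map_pow, hu, ← hy, ← hy, div_pow, div_mul_cancel₀ _ (pow_ne_zero _ (hy0 j))]
    obtain ⟨r, s, hs, rfl⟩ := IsFractionRing.div_surjective (A := k[X]) u
    have hs0 : s ≠ 0 := nonZeroDivisors.ne_zero hs
    have hs1 : algebraMap k[X] E s ≠ 0 := by simpa [map_eq_zero_iff _ hE] using hs0
    have hrs : r ^ q * g j = s ^ q * g i := by
      apply hE
      rw [map_mul, map_mul, ← hpow, map_pow, map_pow, ← mul_assoc, ← mul_pow, mul_div_cancel₀ _ hs1]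
    have hr0 : r ≠ 0 := by
      rintro rfl
      rw [zero_pow (by omega), zero_mul, eq_comm, mul_eq_zero] at hrs
      exact hrs.elim (pow_ne_zero _ hs0) (hg0 i)
    have hroot : ¬ f.IsRoot (θ + (D * i : ℕ) - (D * j : ℕ)) := by
      have := hD ((D : ℤ) * (i - j)) (by
        rw [abs_mul, Nat.abs_cast]
        have : 1 ≤ |(i : ℤ) - j| := Int.one_le_abs (by omega)
        nlinarith)
      convert this using 2
      push_cast
      ring
    have hm := congrArg (rootMultiplicity (θ + (D * i : ℕ))) hrs
    rw [rootMultiplicity_mul (mul_ne_zero (pow_ne_zero _ hr0) (hg0 j)),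
      rootMultiplicity_mul (mul_ne_zero (pow_ne_zero _ hs0) (hg0 i)), rootMultiplicity_pow_eq hr0,
      rootMultiplicity_pow_eq hs0, hmult, hmult, add_sub_cancel_right, hθ] at hm
    rw [rootMultiplicity_eq_zero hroot, add_zero] at hm
    have hdvd : q ∣ q * rootMultiplicity (θ + (D * i : ℕ)) s + 1 := hm ▸ Dvd.intro _ rfl
    have := Nat.le_of_dvd one_pos ((Nat.dvd_add_right (Dvd.intro _ rfl)).1 hdvd)
    omega
  exact not_finite_iff_infinite.2 inferInstance hli.finite

theorem FiniteDimensional.of_essFiniteType (E M : Type*) [Field E] [Field M] [Algebra E M]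
    [Algebra.IsAlgebraic E M] [Algebra.EssFiniteType E M] : FiniteDimensional E M := by
  obtain ⟨s, hs⟩ := IntermediateField.fg_top E M
  have := IntermediateField.finiteDimensional_adjoin (K := E) (S := (s : Set M))
    fun x _ => Algebra.IsIntegral.isIntegral x
  rw [hs] at this
  exact IntermediateField.topEquiv.toLinearEquiv.finiteDimensional

/-- Complete `t` to a transcendence basis and absorb the other elements into the constants. Then `M`
is finite over a rational function field `k₂(t)`, where `k₂` is relatively algebraically closed in
`M` and so contains `ζ` and the coefficients of `f`. -/
theorem exists_aeval_sub_natCast_ne_pow {k M : Type*} [Field k] [CharZero k] [Field M] [Algebra k M]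
    [Algebra.EssFiniteType k M] {t : M} (ht : Transcendental k t) {q : ℕ} (hq : 2 ≤ q) {ζ : M}
    (hζ : IsPrimitiveRoot ζ q) {f : (algebraicClosure k M)[X]} {θ : algebraicClosure k M}
    (hθ : f.rootMultiplicity θ = 1) :
    ∃ c : ℕ, ∀ y : M, y ^ q ≠ aeval (t - c) f := by
  obtain ⟨s, hts, hs⟩ := exists_isTranscendenceBasis_superset (R := k) (s := {t})
    ((algebraicIndependent_singleton_iff (⟨t, rfl⟩ : ({t} : Set M))).2 ht)
  let k₁ := IntermediateField.adjoin k (s \ {t})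
  have ht₁ : Transcendental k₁ t := by
    have := hs.1.transcendental_adjoin (s := {x | (x : M) ≠ t}) (i := ⟨t, hts rfl⟩) (by simp)
    have himg : (Subtype.val '' {x : s | (x : M) ≠ t}) = s \ {t} := by ext; simp [and_comm]
    rw [himg] at this
    exact this.extendScalars k₁
  let k₂ := algebraicClosure k₁ M
  have ht₂ : Transcendental k₂ t := ht₁.extendScalars k₂
  let E := IntermediateField.adjoin k₂ {t}
  have hEalg : Algebra.IsAlgebraic E M := by
    have := hs.isAlgebraic_field
    refine ⟨fun x => ?_⟩
    let E' : IntermediateField k M := (E.restrictScalars k₁).restrictScalars k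
    have hE' : IntermediateField.adjoin k (Set.range ((↑) : s → M)) ≤ E' := by
      rw [Subtype.range_coe, IntermediateField.adjoin_le_iff]
      intro z hz
      by_cases hzt : z = t
      · exact hzt ▸ IntermediateField.mem_adjoin_simple_self k₂ t
      · have hz₁ : z ∈ k₁ := IntermediateField.subset_adjoin k _ ⟨hz, hzt⟩
        exact E.algebraMap_mem (algebraMap k₁ k₂ ⟨z, hz₁⟩)
    exact (this.1 x).ringHom_of_comp_eq
      ((algebraMap (IntermediateField.adjoin k (Set.range ((↑) : s → M))) M).codRestrict E
        fun z => hE' z.2) (RingHom.id M) (fun a b hab => Subtype.ext (congrArg (algebraMap E M) hab)) rfl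
  have : Algebra.EssFiniteType k₁ M := .of_comp k k₁ M
  have : Algebra.EssFiniteType k₂ M := .of_comp k₁ k₂ M
  have : Algebra.EssFiniteType E M := .of_comp k₂ E M
  have : FiniteDimensional E M := .of_essFiniteType E M
  let _ : Algebra k₂[X] E := (aeval (IntermediateField.AdjoinSimple.gen k₂ t)).toAlgebra
  have : IsFractionRing k₂[X] E :=
    IsLocalization.isLocalization_of_algEquiv (nonZeroDivisors k₂[X]) (S := RatFunc k₂)
      (AlgEquiv.ofRingEquiv (f := (RatFunc.algEquivOfTranscendental t ht₂).toRingEquiv)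
        fun g => RatFunc.algEquivOfTranscendental_algebraMap t ht₂ g)
  have hle : ∀ x ∈ algebraicClosure k M, x ∈ k₂ := fun x hx =>
    mem_algebraicClosure_iff'.2 (mem_algebraicClosure_iff'.1 hx).tower_top
  let i : algebraicClosure k M →+* k₂ :=
    (algebraMap (algebraicClosure k M) M).codRestrict k₂ fun x => hle x x.2
  have hζ' : ζ ∈ k₂ := mem_algebraicClosure_iff'.2 ((hζ.isIntegral (by omega)).tower_top)
  obtain ⟨c, hc⟩ := exists_comp_X_sub_C_ne_pow (E := E) (M := M) hq (ζ := (⟨ζ, hζ'⟩ : k₂))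
    (.of_map_of_injective (f := algebraMap k₂ M) hζ (algebraMap k₂ M).injective) (f := f.map i) (θ := i θ)
    (by rwa [← eq_rootMultiplicity_map i.injective])
  refine ⟨c, fun y hy => hc y (hy.trans ?_)⟩
  have h1 (g : k₂[X]) : algebraMap E M (algebraMap k₂[X] E g) = aeval t g :=
    (aeval_algebraMap_apply M (IntermediateField.AdjoinSimple.gen k₂ t) g).symm
  rw [h1, aeval_comp, aeval_def, aeval_def, eval₂_map]
  simp
  rfl

end

/-! ### Kummer descent to an abelian extension -/

section

open Polynomial

/-- If `G` acts on an `n`-th root of unity `ζ` through a cyclic quotient, and on an `n`-th root `β`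
through the same powers up to factors that depend only on `ζ`, then `G` acts on `β` through an
abelian quotient. -/
theorem mul_smul_comm_of_kummer_descent {G L : Type*} [Group G] [Field L] [MulSemiringAction G L]
    {n : ℕ} [NeZero n] {ζ : L} (hζ : IsPrimitiveRoot ζ n) {σ : G}
    (hσ : ∀ g : G, ∃ i : ℤ, g • ζ = σ ^ i • ζ) {β : L} (hβ : β ≠ 0)
    (hβn : ∀ g : G, g • ζ = ζ → g • β ^ n = β ^ n)
    (hd : ∀ g : G, ∃ (x : ℕ) (d : L), g • ζ = ζ ^ x ∧ g • β = β ^ x * d ∧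
      ∀ τ : G, τ • ζ = ζ → τ • d = d) (g h : G) : (g * h) • β = (h * g) • β := by
  -- With `τ β = ζ ^ j * β`, both sides equal `ζ ^ (x * j) * β ^ x * d`.
  have key (τ g : G) (hτ : τ • ζ = ζ) : (τ * g) • β = (g * τ) • β := by
    obtain ⟨x, d, hx, hgβ, hd⟩ := hd g
    have hpow : (τ • β / β) ^ n = 1 := by
      rw [div_pow, ← smul_pow', hβn τ hτ, div_self (pow_ne_zero _ hβ)]
    obtain ⟨j, -, hj⟩ := hζ.eq_pow_of_pow_eq_one hpow
    have hτβ : τ • β = ζ ^ j * β := by rw [hj, div_mul_cancel₀ _ hβ]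
    rw [mul_smul, mul_smul, hgβ, hτβ, smul_mul', smul_pow', smul_mul', smul_pow', hx, hgβ, hτβ,
      hd τ hτ]
    ring
  obtain ⟨i, hi⟩ := hσ g
  obtain ⟨j, hj⟩ := hσ h
  obtain ⟨τ, rfl⟩ : ∃ τ, g = σ ^ i * τ := ⟨(σ ^ i)⁻¹ * g, by group⟩
  obtain ⟨τ', rfl⟩ : ∃ τ', h = σ ^ j * τ' := ⟨(σ ^ j)⁻¹ * h, by group⟩
  have hτ : τ • ζ = ζ := smul_left_cancel (σ ^ i) (by rw [← mul_smul, hi])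
  have hτ' : τ' • ζ = ζ := smul_left_cancel (σ ^ j) (by rw [← mul_smul, hj])
  calc (σ ^ i * τ * (σ ^ j * τ')) • β = σ ^ i • (τ * (σ ^ j * τ')) • β := by
        rw [← mul_smul, mul_assoc]
    _ = (σ ^ i * σ ^ j) • (τ' * τ) • β := by rw [key τ _ hτ]; simp only [← mul_smul, mul_assoc]
    _ = (σ ^ j * σ ^ i) • (τ * τ') • β := by
        rw [key τ τ' hτ, (Commute.refl σ).zpow_zpow i j |>.eq]
    _ = σ ^ j • (τ' * (σ ^ i * τ)) • β := by rw [key τ' _ hτ']; simp only [← mul_smul, mul_assoc]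
    _ = (σ ^ j * τ' * (σ ^ i * τ)) • β := by rw [← mul_smul, mul_assoc]

/-- Weighting the factor `t - c - ζ ^ (u⁻¹)` by `u`, over all units `u` modulo `n`, makes an
automorphism raising `ζ` to the power `χ` raise the product to the power `χ`, up to `n`-th powers
from `K(ζ)`. This is the condition for its `n`-th root to generate an abelian extension. -/
theorem exists_kummer_descent {K k : Type*} [Field K] [Field k] [CharZero k] [Algebra k K]
    [Algebra.EssFiniteType k K] {t : K} (ht : Transcendental k t) {q r : ℕ} (hq : q.Prime)
    (hr : r ≠ 0) {ζ : AlgebraicClosure K} (hζ : IsPrimitiveRoot ζ (q ^ r))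
    {σ : Gal(AlgebraicClosure K/K)} (hσ : ∀ g : Gal(AlgebraicClosure K/K), ∃ i : ℤ, g ζ = (σ ^ i) ζ)
    (M : IntermediateField K (AlgebraicClosure K)) [FiniteDimensional K M] (hM : ζ ∈ M) :
    ∃ β : AlgebraicClosure K, β ≠ 0 ∧ (∀ g h : Gal(AlgebraicClosure K/K), g (h β) = h (g β)) ∧
      β ^ q ^ r ∈ IntermediateField.adjoin K {ζ} ∧ ∀ y ∈ M, y ^ q ≠ β ^ q ^ r := by
  let Ω := AlgebraicClosure K
  set n := q ^ r with hn
  have hn1 : 1 < n := Nat.one_lt_pow hr hq.one_lt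
  have : NeZero n := ⟨by omega⟩
  have : Fact (1 < n) := ⟨hn1⟩
  have : Algebra.EssFiniteType k M := .comp k K M
  have htM : Transcendental k (algebraMap K M t) :=
    (transcendental_algebraMap_iff (algebraMap K M).injective).2 ht
  let ζM : M := ⟨ζ, hM⟩
  have hζM : IsPrimitiveRoot ζM n := .of_map_of_injective (f := algebraMap M Ω) hζ
    (algebraMap M Ω).injective
  let ζC : algebraicClosure k M := ⟨ζM, mem_algebraicClosure_iff'.2 (hζM.isIntegral (by omega)).tower_top⟩
  have hζC : IsPrimitiveRoot ζC n := .of_map_of_injective (f := algebraMap _ M) hζM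
    (algebraMap (algebraicClosure k M) M).injective
  let f : (algebraicClosure k M)[X] :=
    ∏ u : (ZMod n)ˣ, (X - C (ζC ^ (u⁻¹ : (ZMod n)ˣ).val.val)) ^ u.val.val
  -- Only the factor `u = 1`, of exponent one, vanishes at `ζC`.
  have hf : f.rootMultiplicity ζC = 1 := by
    classical
    have hne : ∏ u ∈ Finset.univ.erase (1 : (ZMod n)ˣ),
        (X - C (ζC ^ (u⁻¹ : (ZMod n)ˣ).val.val)) ^ u.val.val ≠ 0 :=
      Finset.prod_ne_zero_iff.2 fun u _ => pow_ne_zero _ (X_sub_C_ne_zero _)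
    have : f = (X - C ζC) * ∏ u ∈ Finset.univ.erase (1 : (ZMod n)ˣ),
        (X - C (ζC ^ (u⁻¹ : (ZMod n)ˣ).val.val)) ^ u.val.val := by
      simp only [f]
      rw [← Finset.mul_prod_erase _ _ (Finset.mem_univ (1 : (ZMod n)ˣ))]
      simp [ZMod.val_one]
    rw [this, rootMultiplicity_mul (mul_ne_zero (X_sub_C_ne_zero _) hne),
      rootMultiplicity_X_sub_C_self, rootMultiplicity_eq_zero]
    rw [IsRoot.def, eval_prod, Finset.prod_eq_zero_iff]
    rintro ⟨u, hu, h⟩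
    rw [eval_pow, eval_sub, eval_X, eval_C] at h
    have h1 : ζC ^ (u⁻¹ : (ZMod n)ˣ).val.val = ζC ^ 1 := by
      rw [pow_one, ← sub_eq_zero.1 (eq_zero_of_pow_eq_zero h)]
    have h2 := hζC.pow_inj (ZMod.val_lt _) hn1 h1
    refine Finset.ne_of_mem_erase hu (inv_eq_one.1 (Units.ext (ZMod.val_injective n ?_)))
    rw [h2, Units.val_one, ZMod.val_one]
  obtain ⟨c, hc⟩ := exists_aeval_sub_natCast_ne_pow htM hq.two_le
    (hζM.pow (by omega) (a := q ^ (r - 1)) (b := q) (by rw [hn, ← pow_succ]; congr 1; omega)) hf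
  let b (x : ZMod n) : Ω := algebraMap K Ω t - c - ζ ^ x.val
  have hb : algebraMap M Ω (aeval (algebraMap K M t - c) f) = ∏ u : (ZMod n)ˣ, b (u⁻¹ : (ZMod n)ˣ) ^ u.val.val := by
    simp only [f, map_prod, map_pow, map_sub, aeval_X, aeval_C, b, map_natCast]
    rfl
  obtain ⟨β, hβ⟩ := IsAlgClosed.exists_pow_nat_eq (∏ u : (ZMod n)ˣ, b (u⁻¹ : (ZMod n)ˣ) ^ u.val.val)
    (show 0 < n by omega)
  have hβM : ∀ y ∈ M, y ^ q ≠ β ^ n := fun y hy h => hc ⟨y, hy⟩ <| (algebraMap M Ω).injective <| by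
    rw [hb, ← hβ, ← h]; rfl
  have hβ0 : β ≠ 0 := by
    rintro rfl
    exact hβM 0 (zero_mem M) (by rw [zero_pow hq.ne_zero, zero_pow (by omega)])
  let N := IntermediateField.adjoin K {ζ}
  have hζN : ζ ∈ N := IntermediateField.mem_adjoin_simple_self K ζ
  have hbN (x : ZMod n) : b x ∈ N :=
    sub_mem (sub_mem (N.algebraMap_mem t) (natCast_mem N c)) (pow_mem hζN _)
  have hβN : β ^ n ∈ N := hβ ▸ prod_mem fun u _ => pow_mem (hbN _) _
  have hNfix (g : Gal(Ω/K)) (hg : g ζ = ζ) (x : Ω) (hx : x ∈ N) : g x = x := by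
    induction hx using IntermediateField.adjoin_induction with
    | mem x hx => rwa [Set.mem_singleton_iff.1 hx]
    | algebraMap x => exact g.commutes x
    | add x y _ _ hx hy => rw [map_add, hx, hy]
    | inv x _ hx => rw [map_inv₀, hx]
    | mul x y _ _ hx hy => rw [map_mul, hx, hy]
  refine ⟨β, hβ0, ?_, hβN, hβM⟩
  refine mul_smul_comm_of_kummer_descent (G := Gal(Ω/K)) hζ hσ hβ0 (fun g hg => hNfix g hg _ hβN)
    fun g => ?_
  let χ := hζ.autToPow K g
  have hχ : ζ ^ χ.val.val = g ζ := hζ.autToPow_spec K g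
  have hgb (x : ZMod n) : g (b x) = b (χ * x) := by
    have hc : g (c : Ω) = c := map_natCast g c
    simp only [b, map_sub, map_pow, hc, ← hχ, ← pow_mul, ZMod.val_mul]
    rw [AlgEquiv.commutes, ← pow_mod_orderOf ζ (_ * _), ← hζ.eq_orderOf]
  -- Reindexing by `u = χ * v` leaves exponents `χ * v` reduced modulo `n`; the quotients lost in
  -- the reduction are collected in `e`.
  let e : Ω := ∏ v : (ZMod n)ˣ, b (v⁻¹ : (ZMod n)ˣ) ^ (χ.val.val * v.val.val / n)
  have heN : e ∈ N := prod_mem fun u _ => pow_mem (hbN _) _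
  have hge : g β ^ n * e ^ n = (β ^ χ.val.val) ^ n := by
    rw [← map_pow, pow_right_comm, hβ, map_prod, ← Finset.prod_pow, ← Finset.prod_pow,
      ← Equiv.prod_comp (Equiv.mulLeft χ), ← Finset.prod_mul_distrib]
    refine Finset.prod_congr rfl fun v _ => ?_
    rw [map_pow, hgb]
    simp only [Equiv.coe_mulLeft, mul_inv_rev, Units.val_mul, ZMod.val_mul]
    rw [mul_left_comm, Units.mul_inv, mul_one, ← pow_mul, ← pow_mul, ← pow_add, mul_comm (_ / n),
      Nat.mod_add_div, mul_comm]
  have he0 : e ≠ 0 := by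
    intro h
    rw [h, zero_pow (by omega), mul_zero, eq_comm, pow_eq_zero_iff (by omega)] at hge
    exact pow_ne_zero _ hβ0 hge
  obtain ⟨j, -, hj⟩ := hζ.eq_pow_of_pow_eq_one (ξ := g β * e / β ^ χ.val.val) (by
    rw [div_pow, mul_pow, hge, div_self (pow_ne_zero _ (pow_ne_zero _ hβ0))])
  refine ⟨χ.val.val, ζ ^ j / e, hχ.symm, ?_, fun τ hτ =>
    hNfix τ hτ _ (div_mem (pow_mem hζN _) heN)⟩
  rw [hj]
  have : β ^ χ.val.val ≠ 0 := pow_ne_zero _ hβ0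
  change g β = _
  field_simp

end

/-! ### Joint surjectivity of Kummer characters -/

theorem Subgroup.pow_prime_pow_eq_one_of_ne_top {G : Type*} [Group G] {q r : ℕ} (hq : q.Prime)
    (hG : Nat.card G = q ^ (r + 1)) {S : Subgroup G} (hS : S ≠ ⊤) {s : G} (hs : s ∈ S) :
    s ^ q ^ r = 1 := by
  have : Finite G := Nat.finite_of_card_ne_zero (by rw [hG]; exact pow_ne_zero _ hq.ne_zero)
  obtain ⟨i, hi, hSi⟩ := (Nat.dvd_prime_pow hq).1 (hG ▸ S.card_subgroup_dvd_card)
  have hi' : i ≠ r + 1 := fun h => hS (S.eq_top_of_card_eq (by rw [hSi, hG, h]))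
  refine orderOf_dvd_iff_pow_eq_one.1 ((Subgroup.orderOf_dvd_natCard S hs).trans ?_)
  rw [hSi]
  exact pow_dvd_pow q (by omega)

open scoped commutatorElement in
theorem mem_fixedField_commutator_iff {K L : Type*} [Field K] [Field L] [Algebra K L] {x : L} :
    x ∈ IntermediateField.fixedField (commutator Gal(L/K)) ↔
      ∀ g h : Gal(L/K), g (h x) = h (g x) := by
  constructor
  · intro hx g h
    have := hx ⟨⁅g⁻¹, h⁻¹⁆, Subgroup.commutator_mem_commutator (Subgroup.mem_top _)
      (Subgroup.mem_top _)⟩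
    have h1 : (g⁻¹ * h⁻¹ * g * h) x = x := by simpa [commutatorElement_def] using this
    calc g (h x) = (h * g * (g⁻¹ * h⁻¹ * g * h)) x := by
          simp only [← AlgEquiv.mul_apply]; congr 1; group
      _ = h (g x) := by rw [AlgEquiv.mul_apply, h1, AlgEquiv.mul_apply]
  · intro hx
    rw [← IntermediateField.mem_toSubfield]
    have : commutator Gal(L/K) ≤ MulAction.stabilizer Gal(L/K) x := by
      rw [commutator_def, Subgroup.commutator_le]
      intro g _ h _
      rw [MulAction.mem_stabilizer_iff, commutatorElement_def]
      change g (h (g⁻¹ (h⁻¹ x))) = x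
      rw [hx g⁻¹ h⁻¹]
      change (g * h * h⁻¹ * g⁻¹) x = x
      simp
    exact fun g => this g.2

/-- A Kummer character is surjective on the absolute Galois group of a field in which the radicand
is not a `q`-th power. -/
theorem kummerCharacter_surjective {K Ω : Type*} [Field K] [Field Ω] [Algebra K Ω] [IsGalois K Ω]
    {q r : ℕ} (hq : q.Prime) (hr : r ≠ 0) {ζ : Ω} (hζ : IsPrimitiveRoot ζ (q ^ r))
    {Γ : Subgroup Gal(Ω/K)} (L : IntermediateField K Ω) (hL : L.fixingSubgroup ≤ Γ) {β : Ω}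
    (hβ : ∀ y ∈ L, y ^ q ≠ β ^ q ^ r) (κ : Γ →* rootsOfUnity (q ^ r) Ω)
    (hκ : ∀ g : Γ, (g : Gal(Ω/K)) β = ((κ g : Ωˣ) : Ω) * β) (w : rootsOfUnity (q ^ r) Ω) :
    ∃ g : Γ, (g : Gal(Ω/K)) ∈ L.fixingSubgroup ∧ κ g = w := by
  obtain ⟨r, rfl⟩ := Nat.exists_eq_succ_of_ne_zero hr
  have : NeZero (q ^ (r + 1)) := ⟨pow_ne_zero _ hq.ne_zero⟩
  suffices h : (L.fixingSubgroup.subgroupOf Γ).map κ = ⊤ by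
    obtain ⟨g, hg, rfl⟩ := h ▸ Subgroup.mem_top w
    exact ⟨g, hg, rfl⟩
  by_contra hne
  -- A proper image would be killed by `q ^ r`, so `β ^ q ^ r` would be Galois-fixed over `L` and be
  -- a forbidden `q`-th root in `L`.
  refine hβ (β ^ q ^ r) ?_ (by rw [← pow_mul, ← pow_succ])
  rw [← InfiniteGalois.fixedField_fixingSubgroup L, IntermediateField.mem_fixedField_iff]
  intro g hg
  have h1 := Subgroup.pow_prime_pow_eq_one_of_ne_top hq (r := r) hζ.card_rootsOfUnity hne
    (Subgroup.mem_map_of_mem κ (x := ⟨g, hL hg⟩) hg)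
  have h2 : ((κ ⟨g, hL hg⟩ : Ωˣ) : Ω) ^ q ^ r = 1 := by
    simpa using congrArg (fun z : rootsOfUnity (q ^ (r + 1)) Ω => ((z : Ωˣ) : Ω)) h1
  rw [map_pow, hκ ⟨g, hL hg⟩, mul_pow, h2, one_mul]

/-- Each new radicand is chosen not to be a `q`-th power in the field `L` built so far. Its
character is then surjective already on `L.fixingSubgroup`, where the earlier ones are trivial, so
its value can be adjusted without disturbing theirs. -/
theorem exists_jointly_surjective_characters {K k : Type*} [Field K] [Field k] [CharZero k]
    [Algebra k K] [Algebra.EssFiniteType k K] {t : K} (ht : Transcendental k t) {ι : Type*} [Finite ι] {q r : ι → ℕ}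
    (hq : ∀ i, (q i).Prime)
    {ζ : ι → AlgebraicClosure K} (hζ : ∀ i, IsPrimitiveRoot (ζ i) (q i ^ r i))
    {σ : ι → Gal(AlgebraicClosure K/K)}
    (hσ : ∀ i, ∀ g : Gal(AlgebraicClosure K/K), ∃ j : ℤ, g (ζ i) = (σ i ^ j) (ζ i))
    (E : IntermediateField K (AlgebraicClosure K)) [FiniteDimensional K E] (hE : ∀ i, ζ i ∈ E)
    (hEab : E ≤ IntermediateField.fixedField (commutator Gal(AlgebraicClosure K/K))) :
    ∃ L : IntermediateField K (AlgebraicClosure K), FiniteDimensional K L ∧ E ≤ L ∧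
      L ≤ IntermediateField.fixedField (commutator Gal(AlgebraicClosure K/K)) ∧
      ∃ φ : ∀ i, E.fixingSubgroup →* rootsOfUnity (q i ^ r i) (AlgebraicClosure K),
        (∀ i, ∀ g : E.fixingSubgroup, (g : Gal(AlgebraicClosure K/K)) ∈ L.fixingSubgroup →
          φ i g = 1) ∧
        ∀ x : ∀ i, rootsOfUnity (q i ^ r i) (AlgebraicClosure K), ∃ g, ∀ i, φ i g = x i := by
  classical
  let Ω := AlgebraicClosure K
  have : CharZero K := charZero_of_injective_algebraMap (algebraMap k K).injective
  have hn (i : ι) : NeZero (q i ^ r i) := ⟨pow_ne_zero _ (hq i).ne_zero⟩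
  cases nonempty_fintype ι
  suffices H : ∀ s : Finset ι, ∃ L : IntermediateField K Ω, FiniteDimensional K L ∧ E ≤ L ∧
      L ≤ IntermediateField.fixedField (commutator Gal(Ω/K)) ∧
      ∃ φ : ∀ i, E.fixingSubgroup →* rootsOfUnity (q i ^ r i) Ω,
        (∀ i ∈ s, ∀ g : E.fixingSubgroup, (g : Gal(Ω/K)) ∈ L.fixingSubgroup → φ i g = 1) ∧
        ∀ x : ∀ i, rootsOfUnity (q i ^ r i) Ω, ∃ g, ∀ i ∈ s, φ i g = x i by
    simpa using H Finset.univ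
  intro s
  induction s using Finset.induction_on with
  | empty => exact ⟨E, inferInstance, le_rfl, hEab, fun _ => 1, by simp, by simp⟩
  | insert j s hj ih =>
    obtain ⟨L, hLfin, hEL, hLab, φ, hφ, hφs⟩ := ih
    by_cases hr : r j = 0
    · refine ⟨L, hLfin, hEL, hLab, φ, ?_, fun x => ?_⟩
      · intro i hi g hg
        rcases Finset.mem_insert.1 hi with rfl | hi
        · have : Subsingleton (rootsOfUnity (q i ^ r i) Ω) := by
            rw [hr, pow_zero, rootsOfUnity_one]; infer_instance
          exact Subsingleton.elim _ _
        · exact hφ i hi g hg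
      · obtain ⟨g, hg⟩ := hφs x
        refine ⟨g, fun i hi => ?_⟩
        rcases Finset.mem_insert.1 hi with rfl | hi
        · have : Subsingleton (rootsOfUnity (q i ^ r i) Ω) := by
            rw [hr, pow_zero, rootsOfUnity_one]; infer_instance
          exact Subsingleton.elim _ _
        · exact hg i hi
    obtain ⟨β, hβ0, hβab, hβn, hβL⟩ := exists_kummer_descent ht (hq j) hr (hζ j) (hσ j) L
      (hEL (hE j))
    have hβE : β ^ q j ^ r j ∈ E :=
      (IntermediateField.adjoin_simple_le_iff.2 (hE j)) hβn
    have hfix (g : E.fixingSubgroup) (x : Ω) (hx : x ∈ E) : (g : Gal(Ω/K)) x = x :=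
      (IntermediateField.mem_fixingSubgroup_iff E _).1 g.2 x hx
    obtain ⟨κ, hκ⟩ := exists_kummerCharacter (G := E.fixingSubgroup) (hζ j)
      (fun g => hfix g _ (hE j)) hβ0 (fun g => hfix g _ hβE)
    have hβint : IsIntegral K β := Algebra.IsIntegral.isIntegral β
    have := IntermediateField.adjoin.finiteDimensional hβint
    have hanti : (L ⊔ IntermediateField.adjoin K {β}).fixingSubgroup ≤ L.fixingSubgroup :=
      IntermediateField.fixingSubgroup_le le_sup_left
    refine ⟨L ⊔ IntermediateField.adjoin K {β}, IntermediateField.finiteDimensional_sup _ _,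
      hEL.trans le_sup_left, sup_le hLab (IntermediateField.adjoin_simple_le_iff.2
        (mem_fixedField_commutator_iff.2 hβab)), Function.update φ j κ, ?_, fun x => ?_⟩
    · intro i hi g hg
      rcases Finset.mem_insert.1 hi with rfl | hi
      · rw [Function.update_self]
        have h1 : (g : Gal(Ω/K)) β = β := (IntermediateField.mem_fixingSubgroup_iff _ _).1 hg β
          (le_sup_right (a := L) (IntermediateField.mem_adjoin_simple_self K β))
        have h2 : (g : Gal(Ω/K)) β = ((κ g : Ωˣ) : Ω) * β := hκ g
        rw [h1, eq_comm, mul_eq_right₀ hβ0] at h2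
        exact Subtype.ext (Units.ext h2)
      · rw [Function.update_of_ne (ne_of_mem_of_not_mem hi hj)]
        exact hφ i hi g (hanti hg)
    · obtain ⟨g, hg⟩ := hφs x
      obtain ⟨h, hhL, hh⟩ := kummerCharacter_surjective (hq j) hr (hζ j) L
        (IntermediateField.fixingSubgroup_le hEL) hβL κ hκ (x j * (κ g)⁻¹)
      refine ⟨h * g, fun i hi => ?_⟩
      rcases Finset.mem_insert.1 hi with rfl | hi
      · rw [Function.update_self, map_mul, hh, inv_mul_cancel_right]
      · rw [Function.update_of_ne (ne_of_mem_of_not_mem hi hj), map_mul, hφ i hi h hhL, one_mul, hg i hi]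

theorem isGaloisGroupOver_pi_rootsOfUnity {k : Type*} {K : Type u} [Field k] [CharZero k] [Field K] [Algebra k K]
    [Algebra.EssFiniteType k K] {t : K} (ht : Transcendental k t)
    {ι : Type*} [Finite ι] {q r : ι → ℕ} (hq : ∀ i, (q i).Prime)
    {ζ : ι → AlgebraicClosure K} (hζ : ∀ i, IsPrimitiveRoot (ζ i) (q i ^ r i))
    {σ : ι → Gal(AlgebraicClosure K/K)}
    (hσ : ∀ i, ∀ g : Gal(AlgebraicClosure K/K), ∃ j : ℤ, g (ζ i) = (σ i ^ j) (ζ i)) :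
    IsGaloisGroupOver K (∀ i, rootsOfUnity (q i ^ r i) (AlgebraicClosure K)) := by
  have : CharZero K := charZero_of_injective_algebraMap (algebraMap k K).injective
  have hn (i : ι) : NeZero (q i ^ r i) := ⟨pow_ne_zero _ (hq i).ne_zero⟩
  let E := IntermediateField.adjoin K (Set.range ζ)
  have : FiniteDimensional K E := IntermediateField.finiteDimensional_adjoin
    fun x _ => Algebra.IsIntegral.isIntegral x
  have hEab : E ≤ IntermediateField.fixedField (commutator Gal(AlgebraicClosure K/K)) := by
    rw [IntermediateField.adjoin_le_iff]
    rintro _ ⟨i, rfl⟩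
    refine mem_fixedField_commutator_iff.2 fun g h => ?_
    rw [← (hζ i).autToPow_spec K g, ← (hζ i).autToPow_spec K h, map_pow, map_pow,
      ← (hζ i).autToPow_spec K g, ← (hζ i).autToPow_spec K h, ← pow_mul, ← pow_mul, mul_comm]
  obtain ⟨L, hL, hEL, hLab, φ, hφL, hφ⟩ := exists_jointly_surjective_characters ht hq hζ hσ E
    (fun i => IntermediateField.subset_adjoin K _ ⟨i, rfl⟩) hEab
  have : L.fixingSubgroup.FiniteIndex :=
    ⟨by rw [← IntermediateField.finrank_eq_fixingSubgroup_index]; exact Module.finrank_pos.ne'⟩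
  obtain ⟨ψ, hψ, hψL⟩ := exists_surjective_of_commutator_le (H := L.fixingSubgroup)
    ((IntermediateField.le_iff_le _ _).1 hLab) (MonoidHom.pi φ)
    (fun x => (hφ x).imp fun g hg => funext hg) (fun g hg => funext fun i => hφL i g hg)
  exact isGaloisGroupOver_of_surjective L ψ hψ hψL

/-! ### Cyclic action on roots of unity, and the conclusion -/

theorem exists_forall_eq_zpow_of_isCyclic_units {K L : Type*} [Field K] [Field L] [Algebra K L] {n : ℕ}
    [NeZero n] [IsCyclic (ZMod n)ˣ] {ζ : L} (hζ : IsPrimitiveRoot ζ n) :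
    ∃ σ : Gal(L/K), ∀ g : Gal(L/K), ∃ i : ℤ, g ζ = (σ ^ i) ζ := by
  obtain ⟨⟨_, σ, rfl⟩, hσ⟩ := IsCyclic.exists_generator (α := (hζ.autToPow K).range)
  refine ⟨σ, fun g => ?_⟩
  obtain ⟨i, hi⟩ := hσ ⟨_, g, rfl⟩
  have h1 : hζ.autToPow K (σ ^ i) = hζ.autToPow K g := by
    rw [map_zpow]; exact congrArg Subtype.val hi
  exact ⟨i, by rw [← hζ.autToPow_spec K g, ← hζ.autToPow_spec K (σ ^ i), h1]⟩

theorem exists_forall_eq_zpow_of_isCyclic_cyclotomicField {K : Type*} [Field K] [CharZero K] {n d : ℕ}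
    [NeZero n] [IsCyclic Gal(CyclotomicField n K/K)] (hd : d ∣ n) {ζ : AlgebraicClosure K}
    (hζ : IsPrimitiveRoot ζ d) :
    ∃ σ : Gal(AlgebraicClosure K/K), ∀ g : Gal(AlgebraicClosure K/K), ∃ i : ℤ,
      g ζ = (σ ^ i) ζ := by
  let C := CyclotomicField n K
  have : FiniteDimensional K C := IsCyclotomicExtension.finiteDimensional {n} K C
  let _ : Algebra C (AlgebraicClosure K) := (IsAlgClosed.lift (R := K)).toRingHom.toAlgebra
  have : IsScalarTower K C (AlgebraicClosure K) :=
    .of_algebraMap_eq fun x => (AlgHom.commutes _ x).symm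
  have : IsGalois K C := IsCyclotomicExtension.isGalois {n} K C
  have : NeZero (n : K) := NeZero.charZero
  have hz := (IsCyclotomicExtension.zeta_spec n K C).map_of_injective
    (algebraMap C (AlgebraicClosure K)).injective
  obtain ⟨τ, hτ⟩ := IsCyclic.exists_generator (α := Gal(C/K))
  obtain ⟨σ, rfl⟩ := AlgEquiv.restrictNormalHom_surjective (F := K) (K₁ := C) (AlgebraicClosure K) τ
  refine ⟨σ, fun g => ?_⟩
  obtain ⟨i, hi⟩ := hτ (AlgEquiv.restrictNormalHom C g)
  refine ⟨i, ?_⟩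
  have hi' : AlgEquiv.restrictNormalHom C (σ ^ i) = AlgEquiv.restrictNormalHom C g := by
    rw [map_zpow]; exact hi
  obtain ⟨j, -, hj⟩ := hz.eq_pow_of_pow_eq_one (ξ := ζ)
    (orderOf_dvd_iff_pow_eq_one.1 (hζ.eq_orderOf ▸ hd))
  rw [← hj, ← map_pow]
  have h1 (g : Gal(AlgebraicClosure K/K)) (x : C) :
      g (algebraMap C _ x) = algebraMap C _ (AlgEquiv.restrictNormalHom C g x) :=
    (AlgEquiv.restrictNormal_commutes g C x).symm
  rw [h1, h1, hi']

theorem corollary3p12 (p : ℕ) [Fact p.Prime] (K : Type*) [Field K]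
    (hK : IsPAdicFunctionField p K) (m : ℕ) (hm : 2 ≤ m)
    (hcyc : IsCyclic Gal(CyclotomicField (2 ^ m) K/K))
    (F : Type*) [CommGroup F] [Finite F] (hF : ¬ 2 ^ (m + 1) ∣ Monoid.exponent F) :
    IsGaloisGroupOver K F := by
  obtain ⟨k, _, _, _, _, t, ht⟩ := hK.exists_transcendental
  have : CharZero K := charZero_of_injective_algebraMap (algebraMap k K).injective
  obtain ⟨ι, _, q, hq, r, ⟨e⟩⟩ := AddCommGroup.equiv_directSum_zmod_of_finite (Additive F)
  let Ω := AlgebraicClosure K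
  have hn (i : ι) : NeZero (q i ^ r i) := ⟨pow_ne_zero _ (hq i).ne_zero⟩
  choose ζ hζ using fun i => HasEnoughRootsOfUnity.exists_primitiveRoot Ω (q i ^ r i)
  have e' (i : ι) : Multiplicative (ZMod (q i ^ r i)) ≃* rootsOfUnity (q i ^ r i) Ω :=
    mulEquivOfCyclicCardEq (by
      rw [HasEnoughRootsOfUnity.natCard_rootsOfUnity, Nat.card_congr Multiplicative.toAdd,
        Nat.card_zmod])
  let Φ : F ≃* ∀ i, rootsOfUnity (q i ^ r i) Ω :=
    (AddEquiv.toMultiplicativeRight (e.trans (DirectSum.addEquivProd _))).trans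
     ((MulEquiv.piMultiplicative _).trans (MulEquiv.piCongrRight e'))
  have hdvd (i : ι) : q i ^ r i ∣ Monoid.exponent F := by
    classical
    let z : rootsOfUnity (q i ^ r i) Ω := (hζ i).toRootsOfUnity
    have : orderOf (Φ.symm (Pi.mulSingle i z)) = q i ^ r i := by
      rw [Φ.symm.orderOf_eq, ← MonoidHom.mulSingle_apply,
        orderOf_injective _ (Pi.mulSingle_injective (M := fun i => rootsOfUnity (q i ^ r i) Ω) i),
        ← Subgroup.orderOf_coe, ← orderOf_units]
      exact (hζ i).eq_orderOf.symm
    exact this ▸ Monoid.order_dvd_exponent _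
  have hσ (i : ι) : ∃ σ : Gal(Ω/K), ∀ g : Gal(Ω/K), ∃ j : ℤ, g (ζ i) = (σ ^ j) (ζ i) := by
    by_cases h2 : q i = 2
    · refine exists_forall_eq_zpow_of_isCyclic_cyclotomicField (n := 2 ^ m) ?_ (hζ i)
      rw [h2]
      refine pow_dvd_pow 2 ?_
      by_contra! hlt
      -- A cyclic 2-factor of order above `2 ^ m` would force `2 ^ (m + 1)` to divide the exponent.
      exact hF ((pow_dvd_pow 2 hlt).trans (h2 ▸ hdvd i))
    · have := ZMod.isCyclic_units_of_prime_pow (q i) (hq i) h2 (r i)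
      exact exists_forall_eq_zpow_of_isCyclic_units (hζ i)
  choose σ hσ using hσ
  obtain ⟨L, _, _, h1, h2, ⟨f⟩⟩ := isGaloisGroupOver_pi_rootsOfUnity ht hq hζ hσ
  exact ⟨L, _, _, h1, h2, ⟨f.trans Φ.symm⟩⟩
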